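/- For rational $a,b$, $z\in\mathbb{C}$ and $\tau$ in the upper half plane, let $$\vartheta_{a,b}(z,\tau)=\sum_{n\in\mathbb{Z}}\exp\bigl(\pi i (n+a)^2\tau+2\pi i (n+a)(z+b)\bigr)$$ be the theta function with characteristics $a,b$. Then $$\vartheta_{0,0}(0,i)=\frac{\Gamma(1/4)}{\sqrt[4]{4\pi^3}}=\frac{\sqrt[4]{\pi}}{\Gamma(3/4)},$$ $$\vartheta_{0,\frac12}(0,i)=\vartheta_{\frac12,0}(0,i)=\frac{\Gamma(1/4)}{\sqrt[4]{(2\pi)^3}}=\frac{\sqrt[4]{\pi}}{\sqrt[4]{2}\,\Gamma(3/4)},$$ where all fourth roots are the positive real ones. -/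

import Mathlib

/-- The theta function with rational characteristics `a, b`:
`ϑ_{a,b}(z,τ) = ∑_{n ∈ ℤ} exp(π i (n+a)² τ + 2 π i (n+a)(z+b))`, for `z ∈ ℂ` and `τ` in the
upper half plane. -/
noncomputable def thetaChar (a b : ℚ) (z : ℂ) (τ : UpperHalfPlane) : ℂ :=
  ∑' n : ℤ, Complex.exp
    ((Real.pi : ℂ) * Complex.I * ((n : ℂ) + (a : ℂ)) ^ 2 * (τ : ℂ)
      + 2 * (Real.pi : ℂ) * Complex.I * ((n : ℂ) + (a : ℂ)) * (z + (b : ℂ)))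

open MeasureTheory Set Filter Topology

/-! This is the arithmetic-geometric mean argument. Write ϑ₃, ϑ₄ for ϑ_{0,0}, ϑ_{0,1/2} at z = 0, τ
= it. Doubling t sends (ϑ₃², ϑ₄²) to its arithmetic and geometric means, and Landen's transformation
says that the elliptic integral does not see this step. Iterating, both entries tend to 1, so the
integral at (ϑ₃², ϑ₄²) is π (`ellipticIntegral_cosKernel`). At t = 1 the symmetry t ↦ 1/t forces ϑ₃²
= √2 ϑ₄², so by homogeneity ϑ₄² is the integral at (√2, 1) divided by π. That integral is a Beta
value, and the reflection formula for Γ gives the closed forms. -/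

/-- The complete elliptic integral `∫_ℝ dx / √((x² + a²)(x² + b²))`. -/
noncomputable def ellipticIntegral (a b : ℝ) : ℝ :=
  ∫ x : ℝ, (√((x ^ 2 + a ^ 2) * (x ^ 2 + b ^ 2)))⁻¹

/-! ### Elliptic integrals and Landen's transformation -/

lemma ellipticIntegral_eq_two_mul_Ioi (a b : ℝ) :
    ellipticIntegral a b = 2 * ∫ x in Ioi (0 : ℝ), (√((x ^ 2 + a ^ 2) * (x ^ 2 + b ^ 2)))⁻¹ := by
  rw [← integral_comp_abs (f := fun x : ℝ => (√((x ^ 2 + a ^ 2) * (x ^ 2 + b ^ 2)))⁻¹)]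
  simp [ellipticIntegral]

lemma landen_injOn {c : ℝ} (hc : 0 < c) : InjOn (fun x : ℝ => (x - c / x) / 2) (Ioi 0) := by
  intro x hx y hy h
  simp only [mem_Ioi] at hx hy h
  have h1 : (x - y) * (1 + c / (x * y)) = 0 := by
    field_simp at h ⊢
    linarith
  have h2 : 0 < 1 + c / (x * y) := by positivity
  rcases mul_eq_zero.mp h1 with h3 | h3
  · linarith
  · exact absurd h3 h2.ne'

lemma landen_image {c : ℝ} (hc : 0 < c) : (fun x : ℝ => (x - c / x) / 2) '' (Ioi 0) = univ := by
  refine eq_univ_of_forall fun t => ?_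
  have h1 : 0 ≤ t ^ 2 + c := by positivity
  have h2 : |t| < √(t ^ 2 + c) := by
    rw [← Real.sqrt_sq_eq_abs]
    exact Real.sqrt_lt_sqrt (sq_nonneg t) (by linarith)
  have h3 : 0 < t + √(t ^ 2 + c) := by linarith [neg_abs_le t]
  -- The positive root of x² - 2tx - c = 0.
  refine ⟨t + √(t ^ 2 + c), h3, ?_⟩
  have h4 := Real.sq_sqrt h1
  simp only
  field_simp
  linear_combination h4

/-- Gauss's form of Landen's transformation. -/
theorem ellipticIntegral_landen {a b g : ℝ} (ha : 0 < a) (hb : 0 < b) (hg : g ^ 2 = a * b) :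
    ellipticIntegral ((a + b) / 2) g = ellipticIntegral a b := by
  have hc : 0 < a * b := mul_pos ha hb
  rw [ellipticIntegral_eq_two_mul_Ioi a b, ellipticIntegral, ← setIntegral_univ,
    ← landen_image hc,
    integral_image_eq_integral_abs_deriv_smul (f' := fun x => (1 + a * b / x ^ 2) / 2)
      measurableSet_Ioi _ (landen_injOn hc), ← integral_const_mul]
  · refine setIntegral_congr_fun measurableSet_Ioi fun x hx => ?_
    simp only [mem_Ioi] at hx
    -- The factors are (x² + a²)(x² + b²)/(4x²) and (x² + ab)²/(4x²); the square root of the second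
    -- cancels the Jacobian.
    have e1 : (((x - a * b / x) / 2) ^ 2 + ((a + b) / 2) ^ 2) * (((x - a * b / x) / 2) ^ 2 + g ^ 2)
        = ((x ^ 2 + a ^ 2) * (x ^ 2 + b ^ 2)) * ((1 + a * b / x ^ 2) / 4) ^ 2 := by
      rw [hg]
      field_simp
      ring
    have h1 : 0 < 1 + a * b / x ^ 2 := by positivity
    have h2 : 0 < √((x ^ 2 + a ^ 2) * (x ^ 2 + b ^ 2)) := Real.sqrt_pos.mpr (by positivity)
    simp only [smul_eq_mul]
    rw [e1, Real.sqrt_mul (by positivity), Real.sqrt_sq (by positivity), abs_of_pos (by positivity)]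
    field_simp
    norm_num
  · intro x hx
    simp only [mem_Ioi] at hx
    have h := (((hasDerivAt_id' x).fun_sub ((hasDerivAt_inv hx.ne').const_mul (a * b))).div_const 2)
    exact (h.congr_deriv (by ring)).hasDerivWithinAt

lemma ellipticIntegral_one_one : ellipticIntegral 1 1 = Real.pi := by
  rw [← integral_univ_inv_one_add_sq, ellipticIntegral]
  refine integral_congr_ae (Eventually.of_forall fun x => ?_)
  simp only
  rw [Real.sqrt_mul_self (by positivity)]
  ring

lemma ellipticIntegral_mul {c : ℝ} (hc : 0 < c) (a b : ℝ) :
    ellipticIntegral (c * a) (c * b) = c⁻¹ * ellipticIntegral a b := by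
  have h := Measure.integral_comp_mul_left
    (fun x : ℝ => (√((x ^ 2 + (c * a) ^ 2) * (x ^ 2 + (c * b) ^ 2)))⁻¹) c
  rw [abs_of_pos (inv_pos.mpr hc), smul_eq_mul] at h
  have h2 : ∫ x : ℝ, (√(((c * x) ^ 2 + (c * a) ^ 2) * ((c * x) ^ 2 + (c * b) ^ 2)))⁻¹
      = (c ^ 2)⁻¹ * ellipticIntegral a b := by
    rw [ellipticIntegral, ← integral_const_mul]
    refine integral_congr_ae (Eventually.of_forall fun x => ?_)
    simp only
    rw [show ((c * x) ^ 2 + (c * a) ^ 2) * ((c * x) ^ 2 + (c * b) ^ 2)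
      = (c ^ 2) ^ 2 * ((x ^ 2 + a ^ 2) * (x ^ 2 + b ^ 2)) by ring,
      Real.sqrt_mul (by positivity), Real.sqrt_sq (by positivity), mul_inv]
  rw [h2] at h
  rw [ellipticIntegral]
  field_simp at h ⊢
  linarith

lemma tendsto_ellipticIntegral_one {u v : ℕ → ℝ} (hu : Tendsto u atTop (𝓝 1))
    (hv : Tendsto v atTop (𝓝 1)) :
    Tendsto (fun n => ellipticIntegral (u n) (v n)) atTop (𝓝 Real.pi) := by
  rw [← ellipticIntegral_one_one]
  have hu' : ∀ᶠ n in atTop, 1 / 2 < u n := hu.eventually (lt_mem_nhds (by norm_num))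
  have hv' : ∀ᶠ n in atTop, 1 / 2 < v n := hv.eventually (lt_mem_nhds (by norm_num))
  refine tendsto_integral_filter_of_dominated_convergence (fun x : ℝ => 4 * (1 + x ^ 2)⁻¹)
    (Eventually.of_forall fun n => Measurable.aestronglyMeasurable (by fun_prop)) ?_
    (integrable_inv_one_add_sq.const_mul 4) (Eventually.of_forall fun x => ?_)
  · filter_upwards [hu', hv'] with n h1 h2
    refine Eventually.of_forall fun x => ?_
    -- Once u, v > 1/2, each factor is at least (1 + x²)/4.
    have h3 : (1 + x ^ 2) / 4 ≤ √((x ^ 2 + u n ^ 2) * (x ^ 2 + v n ^ 2)) := by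
      apply Real.le_sqrt_of_sq_le
      rw [sq]
      gcongr ?_ * ?_ <;> nlinarith [sq_nonneg x]
    rw [Real.norm_of_nonneg (by positivity)]
    calc _ ≤ ((1 + x ^ 2) / 4)⁻¹ := inv_anti₀ (by positivity) h3
      _ = _ := by field_simp
  · refine Tendsto.inv₀ ?_ (Real.sqrt_pos.mpr (by positivity)).ne'
    exact ((tendsto_const_nhds.add (hu.pow 2)).mul (tendsto_const_nhds.add (hv.pow 2))).sqrt

/-! ### The lemniscatic integral as a Beta value -/

lemma beta_eq_integral {α β : ℝ} (hα : 0 < α) (hβ : 0 < β) :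
    ∫ x in Ioo (0 : ℝ) 1, x ^ (α - 1) * (1 - x) ^ (β - 1)
      = Real.Gamma α * Real.Gamma β / Real.Gamma (α + β) := by
  have h : ((∫ x in Ioo (0 : ℝ) 1, x ^ (α - 1) * (1 - x) ^ (β - 1) : ℝ) : ℂ)
      = Complex.betaIntegral α β := by
    rw [Complex.betaIntegral, intervalIntegral.integral_of_le zero_le_one,
      integral_Ioc_eq_integral_Ioo, ← integral_complex_ofReal]
    refine setIntegral_congr_fun measurableSet_Ioo fun x hx => ?_
    have h1 : 0 ≤ 1 - x := by linarith [hx.2]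
    push_cast [Complex.ofReal_cpow hx.1.le, Complex.ofReal_cpow h1]
    rfl
  have h2 := ProbabilityTheory.beta_eq_betaIntegralReal α β hα hβ
  rw [← h, Complex.ofReal_re] at h2
  exact h2.symm

lemma inv_one_add_sq_sq_image :
    (fun u : ℝ => ((1 + u ^ 2) ^ 2)⁻¹) '' (Ioi 0) = Ioo 0 1 := by
  ext s
  simp only [mem_image, mem_Ioi, mem_Ioo]
  constructor
  · rintro ⟨u, hu, rfl⟩
    refine ⟨by positivity, inv_lt_one_of_one_lt₀ ?_⟩
    nlinarith [sq_pos_of_pos hu]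
  · rintro ⟨h0, h1⟩
    have h2 : 0 < √s := Real.sqrt_pos.mpr h0
    have h3 : 1 < (√s)⁻¹ := (one_lt_inv₀ h2).mpr (by
      rw [← Real.sqrt_one]; exact Real.sqrt_lt_sqrt h0.le h1)
    refine ⟨√((√s)⁻¹ - 1), Real.sqrt_pos.mpr (by linarith), ?_⟩
    rw [Real.sq_sqrt (by linarith)]
    simp [Real.sq_sqrt h0.le]

lemma inv_one_add_sq_sq_injOn : InjOn (fun u : ℝ => ((1 + u ^ 2) ^ 2)⁻¹) (Ioi 0) := by
  intro x hx y hy h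
  simp only [mem_Ioi] at hx hy h
  have h1 := (pow_left_inj₀ (by positivity) (by positivity) two_ne_zero).mp (inv_injective h)
  exact (pow_left_inj₀ hx.le hy.le two_ne_zero).mp (by linarith)

/-- The substitution s = (1 + u²)⁻² turns the integral for B(1/4, 1/2) into four times the half-line
integral. -/
theorem ellipticIntegral_sqrt_two_one :
    ellipticIntegral (√2) 1 = Real.Gamma (1 / 4) * √Real.pi / (2 * Real.Gamma (3 / 4)) := by
  have hB := beta_eq_integral (α := 1 / 4) (β := 1 / 2) (by norm_num) (by norm_num)
  rw [← inv_one_add_sq_sq_image,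
    integral_image_eq_integral_abs_deriv_smul
      (f' := fun u => -(2 * (1 + u ^ 2) * (2 * u)) / ((1 + u ^ 2) ^ 2) ^ 2)
      measurableSet_Ioi _ inv_one_add_sq_sq_injOn] at hB
  · have hI : ∫ u in Ioi (0 : ℝ), |-(2 * (1 + u ^ 2) * (2 * u)) / ((1 + u ^ 2) ^ 2) ^ 2| •
        ((((1 + u ^ 2) ^ 2)⁻¹) ^ ((1 / 4 : ℝ) - 1) *
          (1 - ((1 + u ^ 2) ^ 2)⁻¹) ^ ((1 / 2 : ℝ) - 1))
        = 4 * ∫ u in Ioi (0 : ℝ), (√((u ^ 2 + √2 ^ 2) * (u ^ 2 + 1 ^ 2)))⁻¹ := by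
      rw [← integral_const_mul]
      refine setIntegral_congr_fun measurableSet_Ioi fun u hu => ?_
      simp only [mem_Ioi, smul_eq_mul] at hu ⊢
      set w := 1 + u ^ 2 with hw
      have hw0 : 0 < w := by positivity
      have hs : 0 < √w := Real.sqrt_pos.mpr hw0
      have e1 : ((w ^ 2)⁻¹) ^ ((1 / 4 : ℝ) - 1) = w * √w := by
        rw [Real.inv_rpow (by positivity), ← Real.rpow_neg (by positivity), ← Real.rpow_natCast,
          ← Real.rpow_mul hw0.le, Real.sqrt_eq_rpow]
        nth_rewrite 2 [← Real.rpow_one w]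
        rw [← Real.rpow_add hw0]
        norm_num
      have e2 : (1 - (w ^ 2)⁻¹) ^ ((1 / 2 : ℝ) - 1) = w / (u * √(u ^ 2 + 2)) := by
        have e3 : 1 - (w ^ 2)⁻¹ = (u * √(u ^ 2 + 2) / w) ^ 2 := by
          rw [div_pow, mul_pow, Real.sq_sqrt (by positivity)]
          field_simp
          rw [hw]; ring
        rw [e3, ← Real.rpow_natCast, ← Real.rpow_mul (by positivity)]
        norm_num
        rw [Real.rpow_neg_one, inv_div]
      have e4 : |-(2 * w * (2 * u)) / (w ^ 2) ^ 2| = 4 * u / w ^ 3 := by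
        rw [neg_div, abs_neg, abs_of_pos (by positivity)]
        field_simp
        norm_num
      rw [e1, e2, e4, Real.sq_sqrt (by norm_num), one_pow, add_comm (u ^ 2) 1, ← hw,
        Real.sqrt_mul (by positivity)]
      have h5 : 0 < √(u ^ 2 + 2) := Real.sqrt_pos.mpr (by positivity)
      have h6 := Real.sq_sqrt hw0.le
      field_simp
      linear_combination h6
    rw [hI, Real.Gamma_one_half_eq, show (1 / 4 + 1 / 2 : ℝ) = 3 / 4 by norm_num] at hB
    rw [ellipticIntegral_eq_two_mul_Ioi, ← div_div, div_right_comm]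
    linarith
  · intro u hu
    have h0 : (1 + u ^ 2) ^ 2 ≠ 0 := by positivity
    have h := (((hasDerivAt_pow 2 u).const_add 1).fun_pow 2).fun_inv h0
    exact (h.congr_deriv (by norm_num)).hasDerivWithinAt

/-! ### Theta constants on the imaginary axis -/

open HurwitzZeta

lemma hasSum_cosKernel_zero {t : ℝ} (ht : 0 < t) :
    HasSum (fun n : ℤ => Real.exp (-Real.pi * n ^ 2 * t)) (cosKernel 0 t) := by
  have h := hasSum_int_evenKernel 0 ht
  rw [QuotientAddGroup.mk_zero, evenKernel_eq_cosKernel_of_zero] at h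
  simpa using h

lemma hasSum_cosKernel_half {t : ℝ} (ht : 0 < t) :
    HasSum (fun n : ℤ => (-1 : ℝ) ^ n * Real.exp (-Real.pi * n ^ 2 * t))
      (cosKernel ((1 / 2 : ℝ) : UnitAddCircle) t) := by
  have h := hasSum_int_cosKernel (1 / 2) ht
  rw [← Complex.hasSum_ofReal]
  convert h using 2 with n
  have e : Complex.exp (2 * Real.pi * Complex.I * ((1 / 2 : ℝ) : ℂ) * n) = (-1) ^ n := by
    rw [← Complex.exp_pi_mul_I, ← Complex.exp_int_mul]
    congr 1
    push_cast
    ring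
  rw [e]
  push_cast
  rfl

lemma sumDiff_injective :
    Function.Injective (fun p : ℤ × ℤ => ((p.1 + p.2, p.1 - p.2) : ℤ × ℤ)) := by
  rintro ⟨a, b⟩ ⟨c, d⟩ h
  simp only [Prod.mk.injEq] at h ⊢
  omega

/-- A double series supported on pairs of equal parity may be summed over `(a + b, a - b)`. -/
lemma hasSum_comp_sumDiff {f : ℤ × ℤ → ℝ} {s : ℝ} (hf : HasSum f s)
    (h : ∀ p : ℤ × ℤ, ¬ Even (p.1 + p.2) → f p = 0) :
    HasSum (fun p : ℤ × ℤ => f (p.1 + p.2, p.1 - p.2)) s := by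
  refine (sumDiff_injective.hasSum_iff fun p hp => h p fun ⟨k, hk⟩ => hp ?_).mpr hf
  exact ⟨(k, k - p.2), by ext <;> simp; omega⟩

lemma hasSum_mul_prod {f g : ℤ → ℝ} {a b : ℝ} (hf : HasSum f a) (hg : HasSum g b) :
    HasSum (fun p : ℤ × ℤ => f p.1 * g p.2) (a * b) :=
  hf.mul hg (summable_mul_of_summable_norm hf.summable.norm hg.summable.norm)

/-- The identity (a + b)² + (a - b)² = 2(a² + b²) is the source of the doubling of t. -/
lemma exp_sumDiff (a b : ℤ) (t : ℝ) :
    Real.exp (-Real.pi * ((a + b : ℤ) : ℝ) ^ 2 * t) * Real.exp (-Real.pi * ((a - b : ℤ) : ℝ) ^ 2 * t)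
      = Real.exp (-Real.pi * (a : ℝ) ^ 2 * (2 * t)) * Real.exp (-Real.pi * (b : ℝ) ^ 2 * (2 * t)) := by
  rw [← Real.exp_add, ← Real.exp_add]
  congr 1
  push_cast
  ring

lemma neg_one_zpow_eq_of_even_add {m n : ℤ} (h : Even (m + n)) : (-1 : ℝ) ^ m = (-1) ^ n := by
  rcases Int.even_or_odd m with hm | hm
  · rw [hm.neg_one_zpow, ((Int.even_add.mp h).mp hm).neg_one_zpow]
  · have hn : Odd n := by
      rw [← Int.not_even_iff_odd] at hm ⊢
      rwa [← Int.even_add.mp h]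
    rw [hm.neg_one_zpow, hn.neg_one_zpow]

lemma neg_one_zpow_add_eq_zero {m n : ℤ} (h : ¬ Even (m + n)) : (-1 : ℝ) ^ m + (-1) ^ n = 0 := by
  rcases Int.even_or_odd m with hm | hm <;> rcases Int.even_or_odd n with hn | hn
  · exact absurd (hm.add hn) h
  · simp [hm.neg_one_zpow, hn.neg_one_zpow]
  · simp [hm.neg_one_zpow, hn.neg_one_zpow]
  · exact absurd (hm.add_odd hn) h

/-- `ϑ₃² + ϑ₄² = 2 ϑ₃(2τ)²` on the imaginary axis. -/
theorem cosKernel_sq_add_sq {t : ℝ} (ht : 0 < t) :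
    cosKernel 0 t ^ 2 + cosKernel ((1 / 2 : ℝ) : UnitAddCircle) t ^ 2
      = 2 * cosKernel 0 (2 * t) ^ 2 := by
  have h3 := hasSum_cosKernel_zero ht
  have h4 := hasSum_cosKernel_half ht
  have h3' := hasSum_cosKernel_zero (t := 2 * t) (by positivity)
  have hL := (hasSum_mul_prod h3 h3).add (hasSum_mul_prod h4 h4)
  have hR := (hasSum_mul_prod h3' h3').mul_left 2
  have hL' := hasSum_comp_sumDiff hL ?_
  · rw [sq, sq, sq]
    refine hL'.unique (hR.congr_fun fun p => ?_)
    rw [neg_one_zpow_eq_of_even_add (m := p.1 + p.2) (n := p.1 - p.2) ⟨p.1, by ring⟩,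
      mul_mul_mul_comm, exp_sumDiff]
    rcases Int.even_or_odd (p.1 - p.2) with h | h <;> rw [h.neg_one_zpow] <;> ring
  · intro p hp
    have := neg_one_zpow_add_eq_zero hp
    rw [eq_neg_of_add_eq_zero_left this, neg_mul, neg_mul, mul_mul_mul_comm]
    rcases Int.even_or_odd p.2 with h | h <;> rw [h.neg_one_zpow] <;> ring

/-- `ϑ₃ ϑ₄ = ϑ₄(2τ)²` on the imaginary axis. -/
theorem cosKernel_zero_mul_cosKernel_half {t : ℝ} (ht : 0 < t) :
    cosKernel 0 t * cosKernel ((1 / 2 : ℝ) : UnitAddCircle) t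
      = cosKernel ((1 / 2 : ℝ) : UnitAddCircle) (2 * t) ^ 2 := by
  have h3 := hasSum_cosKernel_zero ht
  have h4 := hasSum_cosKernel_half ht
  have h4' := hasSum_cosKernel_half (t := 2 * t) (by positivity)
  -- Adding the product in both orders gives the coefficient (-1)^m + (-1)^n, which vanishes unless
  -- m and n have equal parity.
  have hL := (hasSum_mul_prod h4 h3).add (hasSum_mul_prod h3 h4)
  have hR := (hasSum_mul_prod h4' h4').mul_left 2
  have hL' := hasSum_comp_sumDiff hL ?_
  · have h := hL'.unique (hR.congr_fun fun p => ?_)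
    · linear_combination h / 2
    rw [neg_one_zpow_eq_of_even_add (m := p.1 - p.2) (n := p.1 + p.2) ⟨p.1, by ring⟩,
      mul_left_comm (Real.exp _), mul_assoc, exp_sumDiff, zpow_add₀ (by norm_num)]
    ring
  · intro p hp
    linear_combination (Real.exp (-Real.pi * p.1 ^ 2 * t) * Real.exp (-Real.pi * p.2 ^ 2 * t)) *
      neg_one_zpow_add_eq_zero hp

lemma tendsto_cosKernel_atTop (a : UnitAddCircle) : Tendsto (cosKernel a) atTop (𝓝 1) := by
  obtain ⟨p, hp, h⟩ := isBigO_atTop_cosKernel_sub a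
  have h0 : Tendsto (fun x : ℝ => Real.exp (-p * x)) atTop (𝓝 0) :=
    Real.tendsto_exp_atBot.comp (tendsto_id.const_mul_atTop_of_neg (neg_neg_of_pos hp))
  simpa using (h.trans_tendsto h0).add_const 1

lemma cosKernel_zero_pos {t : ℝ} (ht : 0 < t) : 0 < cosKernel 0 t :=
  (Real.exp_pos _).trans_le
    (le_hasSum (hasSum_cosKernel_zero ht) 0 fun _ _ => (Real.exp_pos _).le)

lemma evenKernel_pos (a : ℝ) {t : ℝ} (ht : 0 < t) : 0 < evenKernel a t :=
  (Real.exp_pos _).trans_le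
    (le_hasSum (hasSum_int_evenKernel a ht) 0 fun _ _ => (Real.exp_pos _).le)

/-- t = 1 is fixed by t ↦ 1/t; at a = 1/2 this is ϑ_{1/2,0} = ϑ_{0,1/2}. -/
lemma evenKernel_one (a : UnitAddCircle) : evenKernel a 1 = cosKernel a 1 := by
  simpa using evenKernel_functional_equation a 1

/-- The series alternates, but the functional equation turns it into one with positive terms. -/
lemma cosKernel_half_pos {t : ℝ} (ht : 0 < t) : 0 < cosKernel ((1 / 2 : ℝ) : UnitAddCircle) t := by
  have h := evenKernel_pos (1 / 2) (inv_pos.mpr ht)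
  rw [evenKernel_functional_equation, one_div t⁻¹, inv_inv] at h
  exact (pos_iff_pos_of_mul_pos h).mp (by positivity)

/-- `ϑ₃(i)² = √2 ϑ₄(i)²`. -/
lemma cosKernel_zero_one_sq :
    cosKernel 0 1 ^ 2 = √2 * cosKernel ((1 / 2 : ℝ) : UnitAddCircle) 1 ^ 2 := by
  have hA := cosKernel_sq_add_sq one_pos
  have hA' := cosKernel_sq_add_sq (t := 1 / 2) (by norm_num)
  have hB' := cosKernel_zero_mul_cosKernel_half (t := 1 / 2) (by norm_num)
  have hF := evenKernel_functional_equation 0 (1 / 2)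
  rw [evenKernel_eq_cosKernel_of_zero, one_div_one_div, ← Real.sqrt_eq_rpow] at hF
  have hF2 : cosKernel 0 (1 / 2) ^ 2 = 2 * cosKernel 0 2 ^ 2 := by
    rw [hF, mul_pow, div_pow, Real.sq_sqrt (by norm_num)]
    norm_num
  norm_num only [mul_one, mul_one_div_cancel] at hA hA' hB' hF2
  rw [← pow_left_inj₀ (n := 2) (by positivity) (by positivity) two_ne_zero, mul_pow,
    Real.sq_sqrt (by norm_num)]
  -- With p = ϑ₃(i)², q = ϑ₄(i)², the squares at t = 1/2 are p + q and p - q, with product q²; hence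
  -- p² = 2q².
  grind

/-- The arithmetic-geometric mean of `ϑ₃²` and `ϑ₄²` is `1`, in integral form. -/
theorem ellipticIntegral_cosKernel {t : ℝ} (ht : 0 < t) :
    ellipticIntegral (cosKernel 0 t ^ 2) (cosKernel ((1 / 2 : ℝ) : UnitAddCircle) t ^ 2)
      = Real.pi := by
  have hconst (n : ℕ) : ellipticIntegral (cosKernel 0 (2 ^ n * t) ^ 2)
      (cosKernel ((1 / 2 : ℝ) : UnitAddCircle) (2 ^ n * t) ^ 2)
      = ellipticIntegral (cosKernel 0 t ^ 2) (cosKernel ((1 / 2 : ℝ) : UnitAddCircle) t ^ 2) := by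
    induction n with
    | zero => simp
    | succ n ih =>
      have hn : 0 < 2 ^ n * t := by positivity
      rw [← ih, ← ellipticIntegral_landen (pow_pos (cosKernel_zero_pos hn) 2)
        (pow_pos (cosKernel_half_pos hn) 2)
        (g := cosKernel ((1 / 2 : ℝ) : UnitAddCircle) (2 ^ (n + 1) * t) ^ 2)]
      · rw [cosKernel_sq_add_sq hn, pow_succ' 2 n, mul_assoc]
        congr 1
        ring
      · rw [pow_succ' 2 n, mul_assoc, ← cosKernel_zero_mul_cosKernel_half hn, mul_pow]
  have hlim : Tendsto (fun n : ℕ => (2 : ℝ) ^ n * t) atTop atTop :=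
    (tendsto_pow_atTop_atTop_of_one_lt one_lt_two).atTop_mul_const ht
  have h (a : UnitAddCircle) : Tendsto (fun n : ℕ => cosKernel a (2 ^ n * t) ^ 2) atTop (𝓝 1) := by
    simpa using ((tendsto_cosKernel_atTop a).comp hlim).pow 2
  have := tendsto_ellipticIntegral_one (h 0) (h ((1 / 2 : ℝ) : UnitAddCircle))
  simp only [hconst] at this
  exact tendsto_nhds_unique tendsto_const_nhds this


/-! ### Gamma values and evaluation at τ = i -/

lemma Gamma_quarter_mul_Gamma_three_quarters :
    Real.Gamma (1 / 4) * Real.Gamma (3 / 4) = √2 * Real.pi := by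
  have h := Real.Gamma_mul_Gamma_one_sub (1 / 4)
  rw [show (1 - 1 / 4 : ℝ) = 3 / 4 by norm_num, show Real.pi * (1 / 4) = Real.pi / 4 by ring,
    Real.sin_pi_div_four] at h
  rw [h]
  have := Real.sq_sqrt (show (0 : ℝ) ≤ 2 by norm_num)
  field_simp
  linear_combination -this

lemma cosKernel_half_one_sq :
    cosKernel ((1 / 2 : ℝ) : UnitAddCircle) 1 ^ 2 = √Real.pi / (√2 * Real.Gamma (3 / 4) ^ 2) := by
  have hpos := cosKernel_half_pos one_pos
  have h := ellipticIntegral_cosKernel one_pos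
  rw [cosKernel_zero_one_sq, mul_comm (√2)] at h
  -- Exposes the common factor ϑ₄² of (ϑ₄²·√2, ϑ₄²·1) for homogeneity.
  nth_rewrite 2 [← mul_one (cosKernel _ _ ^ 2)] at h
  rw [ellipticIntegral_mul (by positivity), ellipticIntegral_sqrt_two_one] at h
  have hG := Gamma_quarter_mul_Gamma_three_quarters
  have hG3 : 0 < Real.Gamma (3 / 4) := Real.Gamma_pos_of_pos (by norm_num)
  rw [eq_div_of_mul_eq hG3.ne' hG] at h
  have h2 := Real.sq_sqrt (show (0 : ℝ) ≤ 2 by norm_num)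
  field_simp at h ⊢
  linear_combination (-√2 / 2) * h + (√Real.pi / 2) * h2

lemma rpow_quarter_pow_four {x : ℝ} (hx : 0 ≤ x) : (x ^ (1 / 4 : ℝ)) ^ 4 = x := by
  rw [← Real.rpow_natCast, ← Real.rpow_mul hx]
  norm_num

lemma cosKernel_half_one :
    cosKernel ((1 / 2 : ℝ) : UnitAddCircle) 1
      = Real.pi ^ (1 / 4 : ℝ) / ((2 : ℝ) ^ (1 / 4 : ℝ) * Real.Gamma (3 / 4)) := by
  have hpos := cosKernel_half_pos one_pos
  have hG3 : 0 < Real.Gamma (3 / 4) := Real.Gamma_pos_of_pos (by norm_num)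
  rw [← pow_left_inj₀ hpos.le (by positivity) four_ne_zero, div_pow, mul_pow,
    rpow_quarter_pow_four Real.pi_pos.le, rpow_quarter_pow_four zero_le_two,
    show 4 = 2 * 2 by rfl, pow_mul, cosKernel_half_one_sq, div_pow, mul_pow,
    Real.sq_sqrt Real.pi_pos.le, Real.sq_sqrt zero_le_two, ← pow_mul]

lemma cosKernel_zero_one :
    cosKernel 0 1 = Real.pi ^ (1 / 4 : ℝ) / Real.Gamma (3 / 4) := by
  have hpos := cosKernel_zero_pos one_pos
  have hG3 : 0 < Real.Gamma (3 / 4) := Real.Gamma_pos_of_pos (by norm_num)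
  rw [← pow_left_inj₀ hpos.le (by positivity) four_ne_zero, div_pow,
    rpow_quarter_pow_four Real.pi_pos.le,
    show 4 = 2 * 2 by rfl, pow_mul, cosKernel_zero_one_sq, cosKernel_half_one_sq, mul_pow, div_pow,
    mul_pow, Real.sq_sqrt Real.pi_pos.le, Real.sq_sqrt zero_le_two, ← pow_mul]
  field_simp

lemma Gamma_quarter_div_eq :
    Real.Gamma (1 / 4) / (4 * Real.pi ^ 3) ^ (1 / 4 : ℝ)
      = Real.pi ^ (1 / 4 : ℝ) / Real.Gamma (3 / 4) := by
  have hG3 : 0 < Real.Gamma (3 / 4) := Real.Gamma_pos_of_pos (by norm_num)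
  have hp := Real.pi_pos
  rw [div_eq_div_iff (by positivity) hG3.ne', Gamma_quarter_mul_Gamma_three_quarters,
    ← pow_left_inj₀ (by positivity) (by positivity) four_ne_zero, mul_pow, mul_pow,
    rpow_quarter_pow_four hp.le, rpow_quarter_pow_four (by positivity), show 4 = 2 * 2 by rfl,
    pow_mul, Real.sq_sqrt zero_le_two]
  ring

lemma Gamma_quarter_div_eq' :
    Real.Gamma (1 / 4) / ((2 * Real.pi) ^ 3) ^ (1 / 4 : ℝ)
      = Real.pi ^ (1 / 4 : ℝ) / ((2 : ℝ) ^ (1 / 4 : ℝ) * Real.Gamma (3 / 4)) := by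
  have hp := Real.pi_pos
  rw [mul_comm (2 ^ _ : ℝ), ← div_div, ← Gamma_quarter_div_eq, div_div,
    ← Real.mul_rpow (by positivity) (by positivity)]
  ring_nf

lemma thetaChar_left_eq (a : ℚ) :
    thetaChar a 0 0 UpperHalfPlane.I = (evenKernel ((a : ℝ) : UnitAddCircle) 1 : ℂ) := by
  rw [← (Complex.hasSum_ofReal.mpr (hasSum_int_evenKernel a one_pos)).tsum_eq]
  refine tsum_congr fun n => ?_
  push_cast
  congr 1
  linear_combination Real.pi * ((n : ℂ) + a) ^ 2 * Complex.I_sq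

lemma thetaChar_right_eq (b : ℚ) :
    thetaChar 0 b 0 UpperHalfPlane.I = (cosKernel ((b : ℝ) : UnitAddCircle) 1 : ℂ) := by
  rw [← (hasSum_int_cosKernel b one_pos).tsum_eq]
  refine tsum_congr fun n => ?_
  push_cast
  rw [← Complex.exp_add]
  congr 1
  linear_combination Real.pi * (n : ℂ) ^ 2 * Complex.I_sq

theorem mainTheorem9 :
    (thetaChar 0 0 0 UpperHalfPlane.I
        = ((Real.Gamma (1 / 4) / (4 * Real.pi ^ 3) ^ (1 / 4 : ℝ) : ℝ) : ℂ) ∧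
      Real.Gamma (1 / 4) / (4 * Real.pi ^ 3) ^ (1 / 4 : ℝ)
        = Real.pi ^ (1 / 4 : ℝ) / Real.Gamma (3 / 4)) ∧
    (thetaChar 0 (1 / 2) 0 UpperHalfPlane.I = thetaChar (1 / 2) 0 0 UpperHalfPlane.I ∧
      thetaChar (1 / 2) 0 0 UpperHalfPlane.I
        = ((Real.Gamma (1 / 4) / ((2 * Real.pi) ^ 3) ^ (1 / 4 : ℝ) : ℝ) : ℂ) ∧
      Real.Gamma (1 / 4) / ((2 * Real.pi) ^ 3) ^ (1 / 4 : ℝ)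
        = Real.pi ^ (1 / 4 : ℝ) / ((2 : ℝ) ^ (1 / 4 : ℝ) * Real.Gamma (3 / 4))) := by
  have h0 := thetaChar_right_eq 0
  have hb := thetaChar_right_eq (1 / 2)
  have ha := thetaChar_left_eq (1 / 2)
  rw [Rat.cast_zero, QuotientAddGroup.mk_zero, cosKernel_zero_one] at h0
  rw [show (((1 / 2 : ℚ) : ℝ)) = 1 / 2 by norm_num] at ha hb
  rw [evenKernel_one] at ha
  refine ⟨⟨?_, Gamma_quarter_div_eq⟩, hb.trans ha.symm, ?_, Gamma_quarter_div_eq'⟩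
  · rw [h0, Gamma_quarter_div_eq]
  · rw [ha, cosKernel_half_one, Gamma_quarter_div_eq']
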